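/- Let $X$ be a complex Banach space and let $T : X \to X$ be a continuous linear operator that is super-recurrent, i.e. for every nonempty open set $U \subseteq X$ there are an integer $n \ge 1$ and $\lambda \in \mathbb{C}$ with $\lambda T^n(U) \cap U \neq \emptyset$. Then there is a real number $R \ge 0$, with $R > 0$ unless $\sigma(T) = \{0\}$, such that every connected component of the spectrum $\sigma(T)$ meets the circle $\{z \in \mathbb{C} : |z| = R\}$. (If $\sigma(T)=\{0\}$, the circle is the degenerate one $\{0\}$.) -/

import Mathlib

/-- A continuous linear operator `T` on a complex normed space `X` is super-recurrent if for every
nonempty open set `U` there are `n ≥ 1` and a scalar `c` such that `c T ^ n (U)` meets `U`. -/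
def IsSuperRecurrent {X : Type*} [NormedAddCommGroup X] [NormedSpace ℂ X] (T : X →L[ℂ] X) : Prop :=
  ∀ U : Set X, IsOpen U → U.Nonempty →
    ∃ n : ℕ, 1 ≤ n ∧ ∃ c : ℂ, (((c • T ^ n : X →L[ℂ] X) '' U) ∩ U).Nonempty

/-! Suppose one component of the spectrum lies in `‖v‖ ≤ m` and another in `‖v‖ > m`, and put `r <
s` in the gap. Riesz-type operators `P, Q ≠ 0` for these two parts satisfy `‖P T ^ n‖ ≤ C r ^ n` and
`Q = B n T ^ n` with `‖B n‖ ≤ D s ^ (-n)`. If `y` and `c T ^ n y` are both close to a vector outside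
the kernels of `P` and `Q`, then `P` bounds `‖c‖` below and `Q` bounds it above; combining the
bounds eliminates `c` and contradicts `(r / s) ^ n → 0` (`not_isSuperRecurrent_of_norm_le`). So
every component's maximal modulus is at least every other's minimal one, and the infimum `R` of the
maxima lies between the two on each component. Contours are avoided: `P` and `Q` are area integrals
of the resolvent against `dbar f`, for a cutoff `f`. Only their nonvanishing matters, not
idempotence. -/

open MeasureTheory Filter Topology Set

/-! ### The `∂̄` operator and Stokes' theorem -/

/-- Twice the Wirtinger derivative `∂f/∂z̄`. -/
noncomputable def dbar (f : ℂ → ℂ) (z : ℂ) : ℂ :=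
  fderiv ℝ f z 1 + Complex.I * fderiv ℝ f z Complex.I

theorem dbar_sub {f g : ℂ → ℂ} {z : ℂ} (hf : DifferentiableAt ℝ f z)
    (hg : DifferentiableAt ℝ g z) : dbar (fun w => f w - g w) z = dbar f z - dbar g z := by
  simp only [dbar, fderiv_fun_sub hf hg, sub_apply]
  ring

theorem dbar_congr {f g : ℂ → ℂ} {z : ℂ} (h : f =ᶠ[𝓝 z] g) : dbar f z = dbar g z := by
  simp only [dbar, h.fderiv_eq]

theorem dbar_const (c : ℂ) (z : ℂ) : dbar (fun _ => c) z = 0 := by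
  simp [dbar]

theorem dbar_mul_holomorphic {f h : ℂ → ℂ} {z : ℂ} (hf : DifferentiableAt ℝ f z)
    (hh : DifferentiableAt ℂ h z) : dbar (fun w => f w * h w) z = dbar f z * h z := by
  have h1 : fderiv ℝ h z = (fderiv ℂ h z).restrictScalars ℝ := hh.fderiv_restrictScalars ℝ
  have h2 : fderiv ℂ h z Complex.I = Complex.I * fderiv ℂ h z 1 := by
    rw [← smul_eq_mul, ← map_smul, smul_eq_mul, mul_one]
  simp only [dbar]
  rw [fderiv_fun_mul hf (hh.restrictScalars ℝ)]
  simp only [add_apply, smul_apply, h1,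
    ContinuousLinearMap.coe_restrictScalars', h2, smul_eq_mul]
  linear_combination (f z * fderiv ℂ h z 1) * Complex.I_mul_I

theorem continuous_dbar {f : ℂ → ℂ} (hf : ContDiff ℝ 1 f) : Continuous (dbar f) := by
  have := hf.continuous_fderiv one_ne_zero
  unfold dbar
  fun_prop

theorem tsupport_dbar_subset (f : ℂ → ℂ) : tsupport (dbar f) ⊆ tsupport f := by
  refine closure_minimal (fun z hz => ?_) (isClosed_tsupport f)
  by_contra h
  refine hz ?_
  rw [dbar_congr (notMem_tsupport_iff_eventuallyEq.mp h)]
  exact dbar_const 0 z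

theorem notMem_tsupport_dbar {f : ℂ → ℂ} {z c : ℂ} (h : ∀ᶠ w in 𝓝 z, f w = c) :
    z ∉ tsupport (dbar f) := by
  rw [notMem_tsupport_iff_eventuallyEq]
  filter_upwards [h.eventually_nhds] with w hw
  rw [dbar_congr (g := fun _ => c) hw]
  exact dbar_const c w

theorem integral_dbar_eq_zero {f : ℂ → ℂ} (hf : ContDiff ℝ 1 f) (hc : HasCompactSupport f) :
    ∫ z, dbar f z = 0 := by
  have hcont := hf.continuous_fderiv one_ne_zero
  have hint (v : ℂ) : Integrable (fun z => fderiv ℝ f z v) :=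
    Continuous.integrable_of_hasCompactSupport (by fun_prop) (hc.fderiv_apply (𝕜 := ℝ) v)
  have key (v : ℂ) : ∫ z, fderiv ℝ f z v = 0 := by
    have := integral_mul_fderiv_eq_neg_fderiv_mul_of_integrable (μ := volume)
      (f := fun _ : ℂ => (1 : ℂ)) (g := f) (v := v) (by simp) (by simpa using hint v)
      (by simpa using hf.continuous.integrable_of_hasCompactSupport hc)
      (fun _ _ => by fun_prop) (fun z _ => hf.differentiable one_ne_zero z)
    simpa using this
  unfold dbar
  rw [integral_add (hint 1) ((hint Complex.I).const_mul _), integral_const_mul, key, key]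
  simp

theorem integral_dbar_mul_eq_zero {f h : ℂ → ℂ} (hf : ContDiff ℝ 1 f) (hc : HasCompactSupport f)
    (hh : ∀ z ∈ tsupport f, ContDiffAt ℂ 1 h z) : ∫ z, dbar f z * h z = 0 := by
  have hsub : tsupport (fun z => f z * h z) ⊆ tsupport f := tsupport_mul_subset_left
  have h1 : ContDiff ℝ 1 (fun z => f z * h z) := by
    refine contDiff_iff_contDiffAt.mpr fun z => ?_
    by_cases hz : z ∈ tsupport f
    · exact hf.contDiffAt.mul ((hh z hz).restrict_scalars ℝ)
    · exact contDiffAt_const.congr_of_eventuallyEq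
        (notMem_tsupport_iff_eventuallyEq.mp fun h => hz (hsub h))
  rw [← integral_dbar_eq_zero h1 hc.mul_right]
  refine integral_congr_ae (.of_forall fun z => ?_)
  by_cases hz : z ∈ tsupport f
  · exact (dbar_mul_holomorphic (hf.differentiable one_ne_zero z)
      ((hh z hz).differentiableAt one_ne_zero)).symm
  · have h0 : dbar f z = 0 := image_eq_zero_of_notMem_tsupport
      fun h => hz (tsupport_dbar_subset f h)
    have h2 : dbar (fun z => f z * h z) z = 0 := image_eq_zero_of_notMem_tsupport
      fun h => hz (hsub (tsupport_dbar_subset _ h))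
    simp only [h0, h2, zero_mul]

section Integrability

variable {E : Type*} [NormedAddCommGroup E] [NormedSpace ℂ E]

theorem integrable_smul_of_continuousAt_tsupport {g : ℂ → ℂ} {k : ℂ → E} (hg : Continuous g)
    (hc : HasCompactSupport g) (hk : ∀ z ∈ tsupport g, ContinuousAt k z) :
    Integrable (fun z => g z • k z) := by
  refine Continuous.integrable_of_hasCompactSupport ?_ hc.smul_right
  refine continuous_of_tsupport fun z hz => ?_
  exact hg.continuousAt.smul (hk z (tsupport_smul_subset_left _ _ hz))

end Integrability

/-! ### Cauchy–Pompeiu and smooth cutoffs -/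

/-- A smooth radial function equal to `1` near `w`, with compact support. -/
noncomputable def radialBump (w z : ℂ) : ℂ :=
  (Real.smoothTransition (2 - ‖z - w‖ ^ 2) : ℂ)

theorem contDiff_radialBump (w : ℂ) : ContDiff ℝ 1 (radialBump w) := by
  have h : ContDiff ℝ 1 (fun z : ℂ => 2 - ‖z - w‖ ^ 2) :=
    contDiff_const.sub ((contDiff_id.sub contDiff_const).norm_sq ℝ)
  exact Complex.ofRealCLM.contDiff.comp ((Real.smoothTransition.contDiff (n := 1)).comp h)

theorem hasCompactSupport_comp_norm_sub {F : Type*} [Zero F] {s : ℝ → F} (hs : ∀ t < 0, s t = 0)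
    (w : ℂ) : HasCompactSupport (fun z : ℂ => s (2 - ‖z - w‖ ^ 2)) := by
  refine HasCompactSupport.intro (isCompact_closedBall w 2) fun z hz => hs _ ?_
  rw [Metric.mem_closedBall, dist_eq_norm, not_le] at hz
  nlinarith

theorem hasCompactSupport_radialBump (w : ℂ) : HasCompactSupport (radialBump w) :=
  hasCompactSupport_comp_norm_sub (s := fun t => (Real.smoothTransition t : ℂ))
    (fun t ht => by simp [Real.smoothTransition.zero_of_nonpos ht.le]) w

theorem radialBump_eventually_eq_one (w : ℂ) : ∀ᶠ z in 𝓝 w, radialBump w z = 1 := by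
  filter_upwards [Metric.ball_mem_nhds w one_pos] with z hz
  rw [Metric.mem_ball, dist_eq_norm] at hz
  have : (1 : ℝ) ≤ 2 - ‖z - w‖ ^ 2 := by nlinarith [norm_nonneg (z - w)]
  simp [radialBump, Real.smoothTransition.one_of_one_le this]

theorem dbar_radialBump (w z : ℂ) : dbar (radialBump w) z =
    -2 * ((deriv Real.smoothTransition (2 - ‖z - w‖ ^ 2) : ℝ) : ℂ) * (z - w) := by
  have h1 : HasFDerivAt (fun z : ℂ => ‖z - w‖ ^ 2) (2 • innerSL ℝ (z - w)) z := by
    simpa using ((hasFDerivAt_id z).sub_const w).norm_sq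
  have h2 : HasDerivAt Real.smoothTransition
      (deriv Real.smoothTransition (2 - ‖z - w‖ ^ 2)) (2 - ‖z - w‖ ^ 2) :=
    (((Real.smoothTransition.contDiff (n := 1)).differentiable one_ne_zero) _).hasDerivAt
  have h3 := (h2.comp_hasFDerivAt z (h1.const_sub 2))
  have h4 : HasFDerivAt (radialBump w) _ z := Complex.ofRealCLM.hasFDerivAt.comp z h3
  rw [dbar, h4.fderiv]
  simp only [ContinuousLinearMap.comp_apply, smul_apply,
    neg_apply, innerSL_apply_apply, Complex.inner, Complex.ofRealCLM_apply]
  apply Complex.ext <;> simp <;> ring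

theorem integral_dbar_radialBump_ne_zero (w : ℂ) :
    ∫ z, dbar (radialBump w) z * (z - w)⁻¹ ≠ 0 := by
  have hcd : Continuous (deriv Real.smoothTransition) :=
    (Real.smoothTransition.contDiff (n := 1)).continuous_deriv le_rfl
  have hloc {c t : ℝ} {s : Set ℝ} (hs : s ∈ 𝓝 t) (h : ∀ x ∈ s, Real.smoothTransition x = c) :
      deriv Real.smoothTransition t = 0 := by
    rw [(eventuallyEq_of_mem hs h : Real.smoothTransition =ᶠ[𝓝 t] fun _ => c).deriv_eq,
      deriv_const]
  set k : ℂ → ℝ := fun z => deriv Real.smoothTransition (2 - ‖z - w‖ ^ 2) with hk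
  have heq : ∀ z, dbar (radialBump w) z * (z - w)⁻¹ = ((-2 * k z : ℝ) : ℂ) := fun z => by
    rw [dbar_radialBump]
    rcases eq_or_ne z w with rfl | h
    · have : k z = 0 := hloc (Ioi_mem_nhds (a := 1) (by norm_num))
        fun x hx => Real.smoothTransition.one_of_one_le (le_of_lt hx)
      simp [this]
    · rw [mul_assoc, mul_inv_cancel₀ (sub_ne_zero.mpr h)]
      simp [hk]
  simp_rw [heq]
  rw [integral_complex_ofReal, integral_const_mul]
  have hpos : 0 < ∫ z, k z := by
    -- The mean value theorem gives a point of slope `1`, so the nonnegative `k` is not identically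
    -- zero.
    obtain ⟨t, ht, hdt⟩ := exists_deriv_eq_slope Real.smoothTransition (a := 0) (b := 1) one_pos
      Real.smoothTransition.continuous.continuousOn
      ((Real.smoothTransition.contDiff (n := 1)).differentiable one_ne_zero).differentiableOn
    refine Continuous.integral_pos_of_hasCompactSupport_nonneg_nonzero (x := w + √(2 - t))
      (by fun_prop) (hasCompactSupport_comp_norm_sub (fun x hx => ?_) w)
      (fun z => Real.smoothTransition.monotone.deriv_nonneg) ?_
    · exact hloc (Iio_mem_nhds hx) fun y hy => Real.smoothTransition.zero_of_nonpos (le_of_lt hy)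
    · have : √(2 - t) ^ 2 = 2 - t := Real.sq_sqrt (by linarith [ht.2])
      simp [hk, this, hdt]
  exact_mod_cast (mul_neg_of_neg_of_pos (by norm_num) hpos).ne

/-- A weak form of the Cauchy–Pompeiu formula. -/
theorem integral_dbar_mul_inv_ne_zero {f : ℂ → ℂ} (hf : ContDiff ℝ 1 f)
    (hc : HasCompactSupport f) {w : ℂ} (hw : ∀ᶠ z in 𝓝 w, f z = 1) :
    ∫ z, dbar f z * (z - w)⁻¹ ≠ 0 := by
  have hint {g : ℂ → ℂ} (hg : ContDiff ℝ 1 g) (hgc : HasCompactSupport g)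
      (h1 : ∀ᶠ z in 𝓝 w, g z = 1) : Integrable (fun z => dbar g z * (z - w)⁻¹) := by
    refine integrable_smul_of_continuousAt_tsupport (continuous_dbar hg)
      (hgc.mono' (subset_closure.trans (tsupport_dbar_subset g))) fun z hz => ?_
    have : z ≠ w := fun h => notMem_tsupport_dbar h1 (h ▸ hz)
    exact ContinuousAt.inv₀ (by fun_prop) (sub_ne_zero.mpr this)
  have hr := contDiff_radialBump w
  have hrc := hasCompactSupport_radialBump w
  have hr1 := radialBump_eventually_eq_one w
  -- `f - radialBump w` vanishes near `w`, so the Cauchy kernel is holomorphic on its support: the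
  -- integral is the same for `f` as for the radial model.
  have h0 : ∫ z, dbar (fun z => f z - radialBump w z) z * (z - w)⁻¹ = 0 := by
    refine integral_dbar_mul_eq_zero (hf.sub hr) (hc.sub hrc) fun z hz => ?_
    have : z ≠ w := by
      rintro rfl
      refine notMem_tsupport_iff_eventuallyEq.mpr ?_ hz
      filter_upwards [hw, hr1] with y hy hy'
      simp [hy, hy']
    exact (contDiffAt_id.sub contDiffAt_const).inv (sub_ne_zero.mpr this)
  have hd (z : ℂ) : dbar (fun z => f z - radialBump w z) z * (z - w)⁻¹ =
      dbar f z * (z - w)⁻¹ - dbar (radialBump w) z * (z - w)⁻¹ := by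
    rw [dbar_sub (hf.differentiable one_ne_zero z) (hr.differentiable one_ne_zero z), sub_mul]
  simp_rw [hd] at h0
  rw [integral_sub (hint hf hc hw) (hint hr hrc hr1), sub_eq_zero] at h0
  rw [h0]
  exact integral_dbar_radialBump_ne_zero w

open scoped Manifold in
theorem exists_contDiff_one_nhdsSet {K U : Set ℂ} (hK : IsCompact K) (hU : IsOpen U)
    (hKU : K ⊆ U) : ∃ f : ℂ → ℂ, ContDiff ℝ 1 f ∧ HasCompactSupport f ∧ tsupport f ⊆ U ∧
      ∀ z ∈ K, ∀ᶠ w in 𝓝 z, f w = 1 := by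
  obtain ⟨L, hL, hKL, hLU⟩ := exists_compact_between hK hU hKU
  obtain ⟨f, h1, h0, -⟩ := exists_contMDiffMap_one_nhds_of_subset_interior (n := 1)
    𝓘(ℝ, ℂ) hK.isClosed hKL
  have hz : ∀ z ∉ L, (f z : ℂ) = 0 := fun z hz => by simp [h0 z hz]
  refine ⟨fun z => (f z : ℂ), Complex.ofRealCLM.contDiff.comp f.contMDiff.contDiff,
    HasCompactSupport.intro hL hz, ?_, fun z hz => ?_⟩
  · refine (closure_minimal (fun z hfz => ?_) hL.isClosed).trans hLU
    by_contra h
    exact hfz (hz z h)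
  · filter_upwards [mem_nhdsSet_iff_forall.mp h1 z hz] with w hw
    have hw' : f w = 1 := hw
    simp [hw']

/-! ### Functional calculus by cutoffs -/

section Resolvent

variable {A : Type*} [NormedRing A] [NormedAlgebra ℂ A]

theorem continuousAt_resolvent [CompleteSpace A] {a : A} {z : ℂ} (hz : z ∈ resolventSet ℂ a) :
    ContinuousAt (resolvent a) z :=
  (spectrum.hasDerivAt_resolvent_const_left hz).continuousAt

theorem resolvent_mul_self {a : A} {z : ℂ} (hz : z ∈ resolventSet ℂ a) :
    resolvent a z * a = z • resolvent a z - 1 := by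
  have h : resolvent a z * (algebraMap ℂ A z - a) = 1 := Ring.inverse_mul_cancel _ hz
  rw [mul_sub, ← Algebra.commutes, ← Algebra.smul_def] at h
  rw [← h]
  abel

theorem self_mul_resolvent {a : A} {z : ℂ} (hz : z ∈ resolventSet ℂ a) :
    a * resolvent a z = z • resolvent a z - 1 := by
  have h : (algebraMap ℂ A z - a) * resolvent a z = 1 := Ring.mul_inverse_cancel _ hz
  rw [sub_mul, ← Algebra.smul_def] at h
  rw [← h]
  abel

variable [CompleteSpace A]

theorem integrable_mul_smul_resolvent {a : A} {g h : ℂ → ℂ} (hg : Continuous g)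
    (hc : HasCompactSupport g) (hga : tsupport g ⊆ resolventSet ℂ a)
    (hh : ∀ z ∈ tsupport g, ContinuousAt h z) :
    Integrable (fun z => (g z * h z) • resolvent a z) := by
  simp_rw [mul_smul]
  exact integrable_smul_of_continuousAt_tsupport hg hc fun z hz =>
    (hh z hz).smul (continuousAt_resolvent (hga hz))

theorem integral_smul_resolvent_mul {a : A} {g h : ℂ → ℂ} (hg : Continuous g)
    (hc : HasCompactSupport g) (hga : tsupport g ⊆ resolventSet ℂ a)
    (hh : ∀ z ∈ tsupport g, ContinuousAt h z) :
    (∫ z, (g z * h z) • resolvent a z) * a =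
      (∫ z, (g z * (z * h z)) • resolvent a z) - (∫ z, g z * h z) • (1 : A) := by
  rw [← integral_mul_const_of_integrable (integrable_mul_smul_resolvent hg hc hga hh),
    ← integral_smul_const, ← integral_sub
      (integrable_mul_smul_resolvent (h := fun z => z * h z) hg hc hga
        fun z hz => continuousAt_id.mul (hh z hz))
      (Integrable.smul_const (f := fun z => g z * h z)
        (integrable_smul_of_continuousAt_tsupport hg hc hh) _)]
  refine integral_congr_ae (.of_forall fun z => ?_)
  by_cases hz : z ∈ tsupport g
  · simp only [smul_mul_assoc, resolvent_mul_self (hga hz), smul_sub, smul_smul]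
    congr 2
    ring
  · simp [image_eq_zero_of_notMem_tsupport hz]

theorem mul_integral_smul_resolvent {a : A} {g h : ℂ → ℂ} (hg : Continuous g)
    (hc : HasCompactSupport g) (hga : tsupport g ⊆ resolventSet ℂ a)
    (hh : ∀ z ∈ tsupport g, ContinuousAt h z) :
    a * (∫ z, (g z * h z) • resolvent a z) = (∫ z, (g z * h z) • resolvent a z) * a := by
  have hi := integrable_mul_smul_resolvent hg hc hga hh
  rw [← integral_mul_const_of_integrable hi, ← integral_const_mul_of_integrable hi]
  refine integral_congr_ae (.of_forall fun z => ?_)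
  by_cases hz : z ∈ tsupport g
  · simp only [smul_mul_assoc, mul_smul_comm, resolvent_mul_self (hga hz),
      self_mul_resolvent (hga hz)]
  · simp [image_eq_zero_of_notMem_tsupport hz]

/-- The analogue of a Riesz projection, up to a nonzero scalar: `f` is a cutoff function equal
to `1` near part of the spectrum of `a`, and `h` is holomorphic on its support. -/
noncomputable def cutoffCalculus (f : ℂ → ℂ) (a : A) (h : ℂ → ℂ) : A :=
  ∫ z, (dbar f z * h z) • resolvent a z

variable {f : ℂ → ℂ} {a : A}

theorem HasCompactSupport.dbar (hc : HasCompactSupport f) : HasCompactSupport (dbar f) :=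
  hc.mono' (subset_closure.trans (tsupport_dbar_subset f))

/-- The identity `R(z) a = z R(z) - 1` leaves the scalar `∫ dbar f * h`, which vanishes by Stokes.
-/
theorem cutoffCalculus_mul_self (hf : ContDiff ℝ 1 f) (hc : HasCompactSupport f)
    (hfa : tsupport (dbar f) ⊆ resolventSet ℂ a) {h : ℂ → ℂ}
    (hh : ∀ z ∈ tsupport f, ContDiffAt ℂ 1 h z) :
    cutoffCalculus f a h * a = cutoffCalculus f a (fun z => z * h z) := by
  rw [cutoffCalculus, integral_smul_resolvent_mul (continuous_dbar hf) hc.dbar hfa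
    fun z hz => (hh z (tsupport_dbar_subset f hz)).continuousAt,
    integral_dbar_mul_eq_zero hf hc hh, zero_smul, sub_zero, cutoffCalculus]

/-- Otherwise, inserting `(z - w)⁻¹` in the integral gives an operator that inverts `w - a` up to
the Cauchy–Pompeiu constant `c ≠ 0`. -/
theorem cutoffCalculus_one_ne_zero (hf : ContDiff ℝ 1 f) (hc : HasCompactSupport f)
    (hfa : tsupport (dbar f) ⊆ resolventSet ℂ a) {w : ℂ} (hw : ∀ᶠ z in 𝓝 w, f z = 1)
    (hwa : w ∈ spectrum ℂ a) : cutoffCalculus f a (fun _ => 1) ≠ 0 := by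
  intro h0
  have hne (z : ℂ) (hz : z ∈ tsupport (dbar f)) : z - w ≠ 0 :=
    sub_ne_zero.mpr fun h => notMem_tsupport_dbar hw (h ▸ hz)
  have hh (z : ℂ) (hz : z ∈ tsupport (dbar f)) : ContinuousAt (fun z => (z - w)⁻¹) z :=
    ContinuousAt.inv₀ (by fun_prop) (hne z hz)
  have hg := continuous_dbar hf
  set c := ∫ z, dbar f z * (z - w)⁻¹ with hcdef
  have hc0 : c ≠ 0 := integral_dbar_mul_inv_ne_zero hf hc hw
  set B := ∫ z, (dbar f z * (z - w)⁻¹) • resolvent a z with hB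
  have h1 : B * a = w • B - c • (1 : A) := by
    rw [hB, integral_smul_resolvent_mul hg hc.dbar hfa hh, ← integral_smul, hcdef]
    congr 1
    rw [← sub_eq_zero, ← integral_sub
      (integrable_mul_smul_resolvent (h := fun z => z * (z - w)⁻¹) hg hc.dbar hfa
        fun z hz => continuousAt_id.mul (hh z hz))
      ((integrable_mul_smul_resolvent hg hc.dbar hfa hh).fun_smul w), ← h0, cutoffCalculus]
    refine integral_congr_ae (.of_forall fun z => ?_)
    by_cases hz : z ∈ tsupport (dbar f)
    · have := hne z hz
      simp only [smul_smul, ← sub_smul]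
      congr 1
      field_simp
    · simp [image_eq_zero_of_notMem_tsupport hz]
  have h2 : a * B = B * a := mul_integral_smul_resolvent hg hc.dbar hfa hh
  have h3 : (algebraMap ℂ A w - a) * (c⁻¹ • B) = 1 := by
    rw [mul_smul_comm, sub_mul, h2, h1, ← Algebra.smul_def, sub_sub_cancel, inv_smul_smul₀ hc0]
  have h4 : (c⁻¹ • B) * (algebraMap ℂ A w - a) = 1 := by
    rw [smul_mul_assoc, mul_sub, h1, ← Algebra.commutes, ← Algebra.smul_def, sub_sub_cancel,
      inv_smul_smul₀ hc0]
  exact hwa (isUnit_iff_exists.mpr ⟨_, h3, h4⟩)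

theorem norm_cutoffCalculus_le (hf : ContDiff ℝ 1 f) (hc : HasCompactSupport f)
    (hfa : tsupport (dbar f) ⊆ resolventSet ℂ a) {h : ℂ → ℂ} {M : ℝ}
    (hh : ∀ z ∈ tsupport f, ‖h z‖ ≤ M) :
    ‖cutoffCalculus f a h‖ ≤ (∫ z, ‖dbar f z • resolvent a z‖) * M := by
  rw [← integral_mul_const]
  refine norm_integral_le_of_norm_le ((integrable_smul_of_continuousAt_tsupport
    (continuous_dbar hf) hc.dbar fun z hz => continuousAt_resolvent (hfa hz)).norm.mul_const M)
    (.of_forall fun z => ?_)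
  by_cases hz : z ∈ tsupport (dbar f)
  · have := hh z (tsupport_dbar_subset f hz)
    rw [norm_smul, norm_smul, norm_mul, mul_right_comm]
    gcongr
  · simp [image_eq_zero_of_notMem_tsupport hz]

-- `f` is locally constant near the spectrum: `1` near the part in `U`, `0` near the rest.
omit [CompleteSpace A] in
theorem exists_cutoff (a : A) {U : Set ℂ} (hU : IsOpen U)
    (hK : IsCompact (spectrum ℂ a ∩ U)) : ∃ f : ℂ → ℂ, ContDiff ℝ 1 f ∧ HasCompactSupport f ∧
      tsupport f ⊆ U ∧ tsupport (dbar f) ⊆ resolventSet ℂ a ∧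
      ∀ z ∈ spectrum ℂ a ∩ U, ∀ᶠ w in 𝓝 z, f w = 1 := by
  obtain ⟨f, hf, hc, hfU, h1⟩ := exists_contDiff_one_nhdsSet hK hU inter_subset_right
  refine ⟨f, hf, hc, hfU, fun z hz => ?_, h1⟩
  by_contra hza
  exact notMem_tsupport_dbar (h1 z ⟨hza, hfU (tsupport_dbar_subset f hz)⟩) hz

theorem exists_norm_mul_pow_le (a : A) {U : Set ℂ} (hU : IsOpen U)
    (hK : IsCompact (spectrum ℂ a ∩ U)) (hne : (spectrum ℂ a ∩ U).Nonempty) {r : ℝ}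
    (hr : ∀ z ∈ U, ‖z‖ ≤ r) : ∃ p : A, p ≠ 0 ∧ ∃ C : ℝ, ∀ n : ℕ, ‖p * a ^ n‖ ≤ C * r ^ n := by
  obtain ⟨f, hf, hc, hfU, hfa, h1⟩ := exists_cutoff a hU hK
  obtain ⟨w, hw⟩ := hne
  refine ⟨cutoffCalculus f a fun _ => 1, cutoffCalculus_one_ne_zero hf hc hfa (h1 w hw) hw.1,
    ∫ z, ‖dbar f z • resolvent a z‖, fun n => ?_⟩
  have hpow : cutoffCalculus f a (fun _ => 1) * a ^ n = cutoffCalculus f a (fun z => z ^ n) := by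
    induction n with
    | zero => simp
    | succ n ih =>
      rw [pow_succ, ← mul_assoc, ih, cutoffCalculus_mul_self hf hc hfa
        (h := fun z => z ^ n) fun z _ => contDiffAt_id.pow n]
      simp_rw [pow_succ']
  rw [hpow]
  refine norm_cutoffCalculus_le hf hc hfa fun z hz => ?_
  rw [norm_pow]
  gcongr
  exact hr z (hfU hz)

theorem exists_mul_pow_eq (a : A) {U : Set ℂ} (hU : IsOpen U)
    (hK : IsCompact (spectrum ℂ a ∩ U)) (hne : (spectrum ℂ a ∩ U).Nonempty) {s : ℝ} (hs : 0 < s)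
    (hsU : ∀ z ∈ U, s ≤ ‖z‖) :
    ∃ p : A, p ≠ 0 ∧ ∃ C : ℝ, ∃ b : ℕ → A, ∀ n : ℕ, b n * a ^ n = p ∧ ‖b n‖ * s ^ n ≤ C := by
  obtain ⟨f, hf, hc, hfU, hfa, h1⟩ := exists_cutoff a hU hK
  obtain ⟨w, hw⟩ := hne
  have hz0 (z : ℂ) (hz : z ∈ tsupport f) : z ≠ 0 :=
    norm_pos_iff.mp (hs.trans_le (hsU z (hfU hz)))
  refine ⟨cutoffCalculus f a fun _ => 1, cutoffCalculus_one_ne_zero hf hc hfa (h1 w hw) hw.1,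
    ∫ z, ‖dbar f z • resolvent a z‖, fun n => cutoffCalculus f a (fun z => z⁻¹ ^ n),
    fun n => ⟨?_, ?_⟩⟩
  · beta_reduce
    induction n with
    | zero => simp
    | succ n ih =>
      rw [pow_succ' a, ← mul_assoc, cutoffCalculus_mul_self hf hc hfa
        (h := fun z => z⁻¹ ^ (n + 1)) fun z hz => (contDiffAt_id.inv (hz0 z hz)).pow _, ← ih]
      congr 1
      refine integral_congr_ae (.of_forall fun z => ?_)
      by_cases hz : z ∈ tsupport f
      · have := hz0 z hz
        simp only [pow_succ', mul_inv_cancel_left₀ this]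
      · simp [image_eq_zero_of_notMem_tsupport fun h => hz (tsupport_dbar_subset f h)]
  · rw [← le_div_iff₀ (by positivity), div_eq_mul_inv]
    refine norm_cutoffCalculus_le hf hc hfa fun z hz => ?_
    rw [norm_pow, norm_inv, inv_pow]
    gcongr
    exact hsU z (hfU hz)

end Resolvent

/-! ### Super-recurrence against a spectral gap -/

section Dynamics

variable {X : Type*} [NormedAddCommGroup X] [NormedSpace ℂ X] {T : X →L[ℂ] X}

theorem IsSuperRecurrent.exists_ge (hT : IsSuperRecurrent T) {U : Set X} (hU : IsOpen U)
    (hne : U.Nonempty) (N : ℕ) : ∃ n ≥ N, ∃ c : ℂ, ∃ y ∈ U, c • (T ^ n) y ∈ U := by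
  induction N with
  | zero =>
    obtain ⟨n, -, c, -, ⟨y, hy, rfl⟩, h⟩ := hT U hU hne
    exact ⟨n, n.zero_le, c, y, hy, h⟩
  | succ N ih =>
    obtain ⟨n, hn, c, y, hy, h⟩ := ih
    -- Recurrence inside the set of returning points composes two returns, raising the exponent by
    -- `m ≥ 1`.
    obtain ⟨m, hm, d, -, ⟨x, hx, rfl⟩, h'⟩ := hT (U ∩ (c • T ^ n) ⁻¹' U)
      (hU.inter (hU.preimage (c • T ^ n).continuous)) ⟨y, hy, h⟩
    refine ⟨n + m, by omega, c * d, x, hx.1, ?_⟩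
    have h2 : c • (T ^ n) (d • (T ^ m) x) ∈ U := h'.2
    rwa [map_smul, smul_smul, ← mul_apply_eq_comp, ← pow_add] at h2

theorem not_isSuperRecurrent_of_norm_le {P Q : X →L[ℂ] X} (hP : P ≠ 0) (hQ : Q ≠ 0)
    {B : ℕ → X →L[ℂ] X} {C D r s : ℝ} (hr : 0 ≤ r) (hrs : r < s)
    (hPT : ∀ n : ℕ, ‖P * T ^ n‖ ≤ C * r ^ n)
    (hQT : ∀ n : ℕ, B n * T ^ n = Q ∧ ‖B n‖ * s ^ n ≤ D) : ¬ IsSuperRecurrent T := by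
  intro hT
  have hs : 0 < s := hr.trans_lt hrs
  -- A vector space is not the union of two proper subspaces, here `ker P` and `ker Q`.
  obtain ⟨x, hPx, hQx⟩ : ∃ x, P x ≠ 0 ∧ Q x ≠ 0 := by
    obtain ⟨x, hx⟩ := DFunLike.ne_iff.mp hP
    obtain ⟨y, hy⟩ := DFunLike.ne_iff.mp hQ
    by_contra! h
    have h1 := h x hx
    have h2 : P y = 0 := by
      by_contra h3
      exact hy (h y h3)
    refine hy ?_
    have := h (x + y) (by simpa [h2] using hx)
    simpa [h1] using this
  obtain ⟨δ, hδ, hδP, hδQ⟩ : ∃ δ : ℝ, 0 < δ ∧ δ < ‖P x‖ ∧ δ < ‖Q x‖ := by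
    obtain ⟨δ, h0, h1⟩ := exists_between (lt_min (norm_pos_iff.mpr hPx) (norm_pos_iff.mpr hQx))
    exact ⟨δ, h0, lt_min_iff.mp h1⟩
  set M := ‖x‖ + 1
  have hM : ‖x‖ < M := lt_add_one _
  have hM0 : 0 < M := (norm_nonneg x).trans_lt hM
  let U : Set X := {y | ‖y‖ < M ∧ δ < ‖P y‖ ∧ δ < ‖Q y‖}
  have hU : IsOpen U := by
    refine IsOpen.and ?_ (IsOpen.and ?_ ?_)
    all_goals exact isOpen_lt (by fun_prop) (by fun_prop)
  have hlim : Tendsto (fun n : ℕ => C * M * D * M * (r / s) ^ n) atTop (𝓝 0) := by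
    simpa using (tendsto_pow_atTop_nhds_zero_of_lt_one (by positivity)
      ((div_lt_one hs).mpr hrs)).const_mul (C * M * D * M)
  obtain ⟨N, hN⟩ := eventually_atTop.mp (hlim.eventually_lt_const (mul_pos hδ hδ))
  obtain ⟨n, hn, c, y, hy, hcy⟩ := hT.exists_ge hU ⟨x, hM, hδP, hδQ⟩ N
  have h1 : δ < ‖c‖ * (C * r ^ n * M) := calc
    δ < ‖c • (P * T ^ n) y‖ := by simpa using hcy.2.1
    _ = ‖c‖ * ‖(P * T ^ n) y‖ := norm_smul _ _
    _ ≤ ‖c‖ * (C * r ^ n * M) := by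
      gcongr
      exact (P * T ^ n).le_of_opNorm_le_of_le (hPT n) hy.1.le
  have h2 : ‖c‖ * δ ≤ ‖B n‖ * M := calc
    ‖c‖ * δ ≤ ‖c‖ * ‖Q y‖ := by gcongr; exact hy.2.2.le
    _ = ‖B n (c • (T ^ n) y)‖ := by rw [map_smul, norm_smul, ← (hQT n).1]; rfl
    _ ≤ ‖B n‖ * M := (B n).le_opNorm_of_le hcy.1.le
  have hE : 0 ≤ C * r ^ n * M := mul_nonneg ((norm_nonneg _).trans (hPT n)) hM0.le
  have h3 : δ * δ ≤ C * M * D * M * (r / s) ^ n := calc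
    δ * δ ≤ ‖c‖ * (C * r ^ n * M) * δ := by gcongr
    _ = (C * r ^ n * M) * (‖c‖ * δ) := by ring
    _ ≤ (C * r ^ n * M) * (‖B n‖ * M) := by gcongr
    _ = (C * r ^ n * M) * ((‖B n‖ * s ^ n) * M / s ^ n) := by field_simp
    _ ≤ (C * r ^ n * M) * (D * M / s ^ n) := by gcongr; exact (hQT n).2
    _ = C * M * D * M * (r / s) ^ n := by rw [div_pow]; ring
  exact absurd h3 (hN n hn).not_ge

end Dynamics

/-! ### Components of the spectrum -/

/-- In a compact Hausdorff space a component is the intersection of the clopen sets around it; by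
compactness one of them already lies in `V`. -/
theorem exists_isOpen_isCompact_inter {S : Set ℂ} (hS : IsCompact S) {z : ℂ} (hz : z ∈ S)
    {V : Set ℂ} (hV : IsOpen V) (hzV : connectedComponentIn S z ⊆ V) :
    ∃ U ⊆ V, IsOpen U ∧ z ∈ U ∧ IsCompact (S ∩ U) := by
  have : CompactSpace S := isCompact_iff_compactSpace.mp hS
  rw [connectedComponentIn_eq_image hz, connectedComponent_eq_iInter_isClopen,
    image_subset_iff] at hzV
  have : Nonempty { s : Set S // IsClopen s ∧ (⟨z, hz⟩ : S) ∈ s } :=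
    ⟨⟨univ, isClopen_univ, mem_univ _⟩⟩
  obtain ⟨W, hW⟩ := exists_subset_nhds_of_isCompact'
    (V := fun s : { s : Set S // IsClopen s ∧ (⟨z, hz⟩ : S) ∈ s } => (s : Set S))
    (fun s t => ⟨⟨s ∩ t, s.2.1.inter t.2.1, s.2.2, t.2.2⟩, inter_subset_left, inter_subset_right⟩)
    (fun s => s.2.1.1.isCompact) (fun s => s.2.1.1)
    (U := (↑) ⁻¹' V) fun x hx => (hV.preimage continuous_subtype_val).mem_nhds (hzV hx)
  obtain ⟨O, hO, hOW⟩ := isOpen_induced_iff.mp W.2.1.2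
  refine ⟨O ∩ V, inter_subset_right, hO.inter hV, ⟨?_, hW W.2.2⟩, ?_⟩
  · have := W.2.2
    rw [← hOW] at this
    exact this
  · convert W.2.1.1.isCompact.image continuous_subtype_val using 1
    ext x
    constructor
    · rintro ⟨hx, hxO, -⟩
      exact ⟨⟨x, hx⟩, hOW ▸ hxO, rfl⟩
    · rintro ⟨y, hy, rfl⟩
      refine ⟨y.2, ?_, hW hy⟩
      rw [← hOW] at hy
      exact hy

theorem isCompact_connectedComponentIn {S : Set ℂ} (hS : IsCompact S) (z : ℂ) :
    IsCompact (connectedComponentIn S z) := by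
  by_cases hz : z ∈ S
  · have : CompactSpace S := isCompact_iff_compactSpace.mp hS
    rw [connectedComponentIn_eq_image hz]
    exact isClosed_connectedComponent.isCompact.image continuous_subtype_val
  · rw [connectedComponentIn_eq_empty hz]
    exact isCompact_empty

theorem IsSuperRecurrent.exists_norm_le {X : Type*} [NormedAddCommGroup X] [NormedSpace ℂ X]
    [CompleteSpace X] {T : X →L[ℂ] X} (hT : IsSuperRecurrent T) {z w : ℂ}
    (hz : z ∈ spectrum ℂ T) (hw : w ∈ spectrum ℂ T) {m : ℝ}
    (hm : ∀ v ∈ connectedComponentIn (spectrum ℂ T) z, ‖v‖ ≤ m) :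
    ∃ v ∈ connectedComponentIn (spectrum ℂ T) w, ‖v‖ ≤ m := by
  by_contra! h
  have hS := spectrum.isCompact (𝕜 := ℂ) T
  obtain ⟨v, hv, hvmin⟩ := (isCompact_connectedComponentIn hS w).exists_isMinOn ⟨w, mem_connectedComponentIn hw⟩
    continuous_norm.continuousOn
  have hm0 : 0 ≤ m := (norm_nonneg z).trans (hm z (mem_connectedComponentIn hz))
  obtain ⟨r, hmr, hrv⟩ := exists_between (h v hv)
  obtain ⟨s, hrs, hsv⟩ := exists_between hrv
  have hr : 0 < r := hm0.trans_lt hmr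
  obtain ⟨U, hUr, hU, hzU, hUc⟩ := exists_isOpen_isCompact_inter hS hz
    (V := {v | ‖v‖ < r}) (isOpen_lt (by fun_prop) (by fun_prop))
    fun v hv => (hm v hv).trans_lt hmr
  obtain ⟨U', hUs, hU', hwU, hUc'⟩ := exists_isOpen_isCompact_inter hS hw
    (V := {v | s < ‖v‖}) (isOpen_lt (by fun_prop) (by fun_prop))
    fun u hu => hsv.trans_le (hvmin hu)
  obtain ⟨P, hP, C, hPT⟩ := exists_norm_mul_pow_le T hU hUc ⟨z, hz, hzU⟩
    (r := r) fun v hv => (hUr hv).le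
  obtain ⟨Q, hQ, D, B, hQT⟩ := exists_mul_pow_eq T hU' hUc' ⟨w, hw, hwU⟩
    (hr.trans hrs) fun v hv => (hUs hv).le
  exact not_isSuperRecurrent_of_norm_le hP hQ hr.le hrs hPT hQT hT

theorem theorem4p1 {X : Type*} [NormedAddCommGroup X] [NormedSpace ℂ X] [CompleteSpace X]
    (T : X →L[ℂ] X) (hT : IsSuperRecurrent T) :
    ∃ R : ℝ, 0 ≤ R ∧ (spectrum ℂ T ≠ {0} → 0 < R) ∧
      ∀ z ∈ spectrum ℂ T,
        (connectedComponentIn (spectrum ℂ T) z ∩ {w : ℂ | ‖w‖ = R}).Nonempty := by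
  have hS := spectrum.isCompact (𝕜 := ℂ) T
  set S := spectrum ℂ T with hSdef
  rcases S.eq_empty_or_nonempty with hempty | ⟨z₀, hz₀⟩
  -- Any positive radius serves here.
  · exact ⟨1, zero_le_one, fun _ => one_pos, by simp [hempty]⟩
  let M : Set ℝ := {m | ∃ z ∈ S, ∀ v ∈ connectedComponentIn S z, ‖v‖ ≤ m}
  have hmax (z : ℂ) (hz : z ∈ S) : ∃ u ∈ connectedComponentIn S z, ‖u‖ ∈ M := by
    obtain ⟨u, hu, humax⟩ := (isCompact_connectedComponentIn hS z).exists_isMaxOn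
      ⟨z, mem_connectedComponentIn hz⟩ continuous_norm.continuousOn
    exact ⟨u, hu, z, hz, fun v hv => humax hv⟩
  have hne : M.Nonempty := (hmax z₀ hz₀).imp' _ fun _ h => h.2
  have hbdd : ∀ m ∈ M, 0 ≤ m := fun m ⟨z, hz, hm⟩ =>
    (norm_nonneg z).trans (hm z (mem_connectedComponentIn hz))
  have hmin (w : ℂ) (hw : w ∈ S) : ∃ v ∈ connectedComponentIn S w, ‖v‖ ≤ sInf M := by
    obtain ⟨v, hv, hvmin⟩ := (isCompact_connectedComponentIn hS w).exists_isMinOn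
      ⟨w, mem_connectedComponentIn hw⟩ continuous_norm.continuousOn
    refine ⟨v, hv, le_csInf hne fun m ⟨z, hz, hm⟩ => ?_⟩
    obtain ⟨u, hu, hum⟩ := hT.exists_norm_le hz hw hm
    exact (hvmin hu).trans hum
  have hR : 0 ≤ sInf M := le_csInf hne hbdd
  refine ⟨sInf M, hR, fun hS0 => hR.lt_of_ne fun h0 => hS0 ?_, fun z hz => ?_⟩
  -- If `R = 0`, every component contains `0`, so there is only one, and its maximal modulus is `0`.
  · have hzero (w : ℂ) (hw : w ∈ S) : (0 : ℂ) ∈ connectedComponentIn S w := by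
      obtain ⟨v, hv, hv0⟩ := hmin w hw
      rw [← h0, norm_le_zero_iff] at hv0
      exact hv0 ▸ hv
    have hall (w : ℂ) (hw : w ∈ S) : w = 0 := by
      refine norm_le_zero_iff.mp (h0 ▸ le_csInf hne fun m ⟨z, hz, hm⟩ => hm w ?_)
      rw [connectedComponentIn_eq (hzero z hz), ← connectedComponentIn_eq (hzero w hw)]
      exact mem_connectedComponentIn hw
    exact eq_singleton_iff_nonempty_unique_mem.mpr ⟨⟨z₀, hz₀⟩, hall⟩
  · obtain ⟨v, hv, hvR⟩ := hmin z hz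
    obtain ⟨u, hu, huM⟩ := hmax z hz
    obtain ⟨x, hx, hxR⟩ := isPreconnected_connectedComponentIn.intermediate_value hv hu
      continuous_norm.continuousOn ⟨hvR, csInf_le ⟨0, hbdd⟩ huM⟩
    exact ⟨x, hx, hxR⟩
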